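/- For all $k,l,m\in\mathbb N$ with $m\ge 1$ there exist a real number $p<1$ and $K\in\mathbb N$, depending only on $k,l,m$, such that the following holds. Let $G$ be a group, $X_0\subseteq G$ a finite non-empty subset, and $X=X_0^{-1}X_0=\{x^{-1}y: x,y\in X_0\}$. For $a\in G$ write $a^X=\{x^{-1}ax : x\in X\}$, and for subsets $A,B$ of $G$ write $AB=\{ab: a\in A,\ b\in B\}$. Assume that $|X_0X|\le k|X_0|$, and that an $l$-tuple $(a_1,\dots,a_l)$ chosen uniformly at random from the Cartesian power $X^{(l)}$ satisfies $$|a_1^X\cdots a_l^X|\ \ge\ |X|/m$$ with probability at least $p$ (for $l=0$ the empty product is $\{1\}$). Then there is a subgroup $S$ of $G$ with $S\subseteq X^2=XX$ such that $X$ is contained in the union of at most $K$ left cosets of $S$. -/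

import Mathlib

open scoped Pointwise

/-- The set `a^X = {x⁻¹ a x : x ∈ X}` of `X`-conjugates of `a`. -/
def conjBy {G : Type*} [Group G] [DecidableEq G] (X : Finset G) (a : G) : Finset G :=
  X.image (fun x => x⁻¹ * a * x)

/-- The set product `a_1^X ⋯ a_l^X`, in this order (it is `{1}` when `l = 0`). -/
def conjProd {G : Type*} [Group G] [DecidableEq G] (X : Finset G) {l : ℕ} (a : Fin l → G) :
    Finset G :=
  (List.ofFn (fun i => conjBy X (a i))).prod

open Classical in
/-- The probability that an `l`-tuple, chosen uniformly at random from the Cartesian power of the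
finite non-empty set `X`, has the property `P`. -/
noncomputable def tupleProb {G : Type*} (X : Finset G) (l : ℕ) (P : (Fin l → G) → Prop) : ℝ :=
  (((Fintype.piFinset (fun _ : Fin l => X)).filter P).card : ℝ) /
    ((Fintype.piFinset (fun _ : Fin l => X)).card : ℝ)

/-- `X` is contained in the union of at most `K` (left) cosets of the subgroup `S`. -/
def CoveredByCosets {G : Type*} [Group G] (X : Finset G) (S : Subgroup G) (K : ℕ) : Prop :=
  ∃ C : Finset G, C.card ≤ K ∧ (X : Set G) ⊆ ⋃ c ∈ C, c • (S : Set G)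

open Finset

universe u

/-! Write `A` for `X₀`. Small tripling gives a dense symmetric `S` with a long power `S ^ M` inside
`X²` (`exists_dense_pow_subset`), and then a dense `T ⊆ X` all of whose `X`-conjugates lie in `S ^
8` (`exists_dense_conj_mem_pow`). Tuples from `T` have positive proportion, so for `p` near 1 one of
them satisfies the hypothesis; its conjugate product lies in `W = S ^ (8l)`, whence `|W| ≥ |X|/m`.

Many powers of `W` stay in `X²`, of size `O(|W|)`, while powers that keep growing gain `|W|` every
three steps. So some power stabilises and is a subgroup; Ruzsa covering bounds the number of cosets.
-/

/-! ### Dense sets with a long power inside `X²`. -/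

lemma card_sdiff_mul_smul_le {G : Type*} [Group G] [DecidableEq G] (P : Finset G) (x y : G) :
    #(P \ (x * y) • P) ≤ #(P \ x • P) + #(P \ y • P) := by
  have h : P \ (x * y) • P ⊆ (P \ x • P) ∪ x • (P \ y • P) := by
    intro z hz
    rw [mem_sdiff] at hz
    by_cases hx : z ∈ x • P
    · refine mem_union_right _ ?_
      rw [smul_finset_sdiff, smul_smul]
      exact mem_sdiff.2 ⟨hx, hz.2⟩
    · exact mem_union_left _ (mem_sdiff.2 ⟨hz.1, hx⟩)
  calc _ ≤ _ := card_le_card h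
    _ ≤ _ := card_union_le _ _
    _ = _ := by rw [card_smul_finset]

lemma card_sdiff_smul_le_of_mem_pow {G : Type*} [Group G] [DecidableEq G] (P S : Finset G)
    (b : ℝ) (h : ∀ x ∈ S, (#(P \ x • P) : ℝ) ≤ b) (n : ℕ) :
    ∀ x ∈ S ^ n, (#(P \ x • P) : ℝ) ≤ n * b := by
  induction n with
  | zero =>
    intro x hx
    obtain rfl : x = 1 := by simpa using hx
    simp
  | succ n ih =>
    intro x hx
    rw [pow_succ] at hx
    obtain ⟨y, hy, z, hz, rfl⟩ := mem_mul.1 hx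
    have h1 : (#(P \ (y * z) • P) : ℝ) ≤ #(P \ y • P) + #(P \ z • P) := by
      exact_mod_cast card_sdiff_mul_smul_le P y z
    have := ih y hy
    have := h z hz
    push_cast
    linarith

lemma sum_card_inter_smul {G : Type*} [Group G] [DecidableEq G] (B X : Finset G)
    (h : B * B⁻¹ ⊆ X) : ∑ x ∈ X, #(B ∩ x • B) = #B * #B := by
  rw [← card_product,
    card_eq_sum_card_fiberwise (f := fun p : G × G => p.1 * p.2⁻¹) (t := X)]
  · refine sum_congr rfl fun x _ => ?_
    refine card_bij' (fun b _ => (b, x⁻¹ * b)) (fun p _ => p.1) ?_ ?_ ?_ ?_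
    · intro b hb
      rw [mem_inter, ← inv_smul_mem_iff] at hb
      simpa using hb
    · rintro ⟨b, c⟩ hb
      simp only [mem_filter, mem_product] at hb
      rw [mem_inter, ← inv_smul_mem_iff]
      obtain ⟨⟨hb, hc⟩, rfl⟩ := hb
      simpa [hb] using hc
    · simp
    · rintro ⟨b, c⟩ hb
      simp only [mem_filter, mem_product] at hb
      obtain ⟨⟨hb, hc⟩, rfl⟩ := hb
      simp
  · rintro ⟨b, c⟩ hb
    simp only [coe_product, Set.mem_prod, mem_coe] at hb
    exact h (mul_mem_mul hb.1 (inv_mem_inv hb.2))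

/-- The set of `x` for which `B` and its translate by `x` meet substantially is large. -/
lemma card_filter_card_inter_smul_ge {G : Type*} [Group G] [DecidableEq G] {A B : Finset G}
    {k t : ℝ} (hk : 1 ≤ k) (ht : 0 < t) (hA : A.Nonempty) (hX : (#(A⁻¹ * A) : ℝ) ≤ k * #A)
    (hB : B ⊆ A⁻¹) (hBt : t * #A ≤ #B) :
    t ^ 2 / (2 * k) * #(A⁻¹ * A) ≤
      #{x ∈ A⁻¹ * A | t ^ 2 / (2 * k) * #A ≤ (#(B ∩ x • B) : ℝ)} := by
  set X := A⁻¹ * A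
  set s := t ^ 2 / (2 * k) with hs
  have hs0 : 0 < s := by positivity
  have hsk : s * k = t ^ 2 / 2 := by rw [hs]; field_simp
  have hA0 : (0 : ℝ) < #A := by exact_mod_cast hA.card_pos
  have hBA : (#B : ℝ) ≤ #A := by
    have := card_le_card hB
    rw [card_inv] at this
    exact_mod_cast this
  have hBB : B * B⁻¹ ⊆ X := mul_subset_mul hB (by simpa using inv_subset_inv hB)
  have hsum : (∑ x ∈ X, (#(B ∩ x • B) : ℝ)) = #B * #B := by
    exact_mod_cast sum_card_inter_smul B X hBB
  rw [← sum_filter_add_sum_filter_not X (fun x => s * #A ≤ (#(B ∩ x • B) : ℝ))] at hsum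
  have h1 : ∑ x ∈ X with s * #A ≤ (#(B ∩ x • B) : ℝ), (#(B ∩ x • B) : ℝ) ≤
      #{x ∈ X | s * #A ≤ (#(B ∩ x • B) : ℝ)} * #A := by
    rw [← nsmul_eq_mul]
    refine sum_le_card_nsmul _ _ _ fun x _ => le_trans ?_ hBA
    exact_mod_cast card_le_card inter_subset_left
  have h2 : ∑ x ∈ X with ¬ s * #A ≤ (#(B ∩ x • B) : ℝ), (#(B ∩ x • B) : ℝ) ≤
      #X * (s * #A) := by
    refine (sum_le_card_nsmul _ _ (s * #A) fun x hx => ?_).trans ?_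
    · exact (not_le.1 (mem_filter.1 hx).2).le
    · rw [nsmul_eq_mul]
      gcongr
      exact filter_subset _ _
  have h3 : t ^ 2 * (#A * #A) ≤ #B * #B := by
    have : t * #A * (t * #A) ≤ #B * #B := by gcongr
    linarith
  have h4 : #X * (s * #A) ≤ t ^ 2 / 2 * (#A * #A) := by
    calc #X * (s * #A) ≤ (k * #A) * (s * #A) := by gcongr
      _ = (s * k) * (#A * #A) := by ring
      _ = _ := by rw [hsk]
  refine le_of_mul_le_mul_right ?_ hA0
  have h5 : s * #X * #A = #X * (s * #A) := by ring
  linarith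

/-- Take for `S` the popular `x`, those with `B ∩ xB` large. If each such `x` nearly preserves
`|BA|`, it moves `P = BA` by at most `|P|/(M+1)`, so a product of `M` of them still makes `P` meet
its translate and lies in `PP⁻¹ ⊆ X²`. Otherwise pass to some `B ∩ xB`: `|BA|` drops by a fixed
factor, which can happen fewer than `n` times since `|BA| ≥ |A|`. -/
lemma exists_dense_pow_subset_aux (k : ℝ) (hk : 1 ≤ k) (M n : ℕ) :
    ∀ t : ℝ, 0 < t → ∃ c : ℝ, 0 < c ∧
      ∀ (G : Type u) [Group G] [DecidableEq G] (A B : Finset G), A.Nonempty →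
        (#(A⁻¹ * A) : ℝ) ≤ k * #A → B ⊆ A⁻¹ → t * #A ≤ #B →
        #(B * A) * (1 - 1 / ((M : ℝ) + 1)) ^ n < #A →
        ∃ S ⊆ A⁻¹ * A, 1 ∈ S ∧ S⁻¹ = S ∧ c * #(A⁻¹ * A) ≤ #S ∧
          S ^ M ⊆ (A⁻¹ * A) * (A⁻¹ * A) := by
  have hM : (0 : ℝ) < (M : ℝ) + 1 := by positivity
  have hδ : 0 ≤ 1 - 1 / ((M : ℝ) + 1) := by
    rw [sub_nonneg, div_le_one hM]; linarith [Nat.cast_nonneg (α := ℝ) M]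
  induction n with
  | zero =>
    intro t ht
    refine ⟨1, one_pos, fun G _ _ A B hA _ _ hBt hlt => ?_⟩
    have hA0 : (0 : ℝ) < #A := by exact_mod_cast hA.card_pos
    have hB : B.Nonempty := by
      rw [← card_pos, ← Nat.cast_pos (α := ℝ)]
      exact (mul_pos ht hA0).trans_le hBt
    have : #A ≤ #(B * A) := card_le_card_mul_left hB
    rw [pow_zero, mul_one, Nat.cast_lt] at hlt
    omega
  | succ n ih =>
    intro t ht
    set s := t ^ 2 / (2 * k) with hs
    have hs0 : 0 < s := by positivity
    obtain ⟨c, hc, ih⟩ := ih s hs0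
    refine ⟨min c s, lt_min hc hs0, fun G _ _ A B hA hX hB hBt hlt => ?_⟩
    have hA0 : (0 : ℝ) < #A := by exact_mod_cast hA.card_pos
    by_cases hcase : ∀ x ∈ {x ∈ A⁻¹ * A | s * #A ≤ (#(B ∩ x • B) : ℝ)},
        (1 - 1 / ((M : ℝ) + 1)) * #(B * A) ≤ #((B ∩ x • B) * A)
    · refine ⟨{x ∈ A⁻¹ * A | s * #A ≤ (#(B ∩ x • B) : ℝ)}, filter_subset _ _, ?_, ?_, ?_, ?_⟩
      · rw [mem_filter]
        constructor
        · obtain ⟨a, ha⟩ := hA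
          exact mem_mul.2 ⟨a⁻¹, inv_mem_inv ha, a, ha, by simp⟩
        · have hBA : (#B : ℝ) ≤ #A := by
            have := card_le_card hB
            rw [card_inv] at this
            exact_mod_cast this
          have ht1 : t ≤ 1 := by
            refine le_of_mul_le_mul_right ?_ hA0
            linarith
          have hst : s ≤ t := by
            rw [hs, div_le_iff₀ (by positivity)]
            nlinarith
          have : s * #A ≤ t * #A := by gcongr
          simpa using this.trans hBt
      · ext x
        rw [mem_inv']
        simp only [mem_filter]
        have h1 : x⁻¹ ∈ A⁻¹ * A ↔ x ∈ A⁻¹ * A := by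
          rw [← mem_inv', mul_inv_rev, inv_inv]
        have h2 : #(B ∩ x⁻¹ • B) = #(B ∩ x • B) := by
          rw [← card_smul_finset x (B ∩ x⁻¹ • B), smul_finset_inter, smul_inv_smul, inter_comm]
        rw [h1, h2]
      · refine le_trans ?_ (card_filter_card_inter_smul_ge hk ht hA hX hB hBt)
        gcongr
        exact min_le_right _ _
      · set P := B * A with hP
        have hBn : B.Nonempty := by
          rw [← card_pos, ← Nat.cast_pos (α := ℝ)]
          exact (mul_pos ht hA0).trans_le hBt
        have hP0 : (0 : ℝ) < #P := by exact_mod_cast (hBn.mul hA).card_pos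
        intro x hx
        have hd : ∀ y ∈ {x ∈ A⁻¹ * A | s * #A ≤ (#(B ∩ x • B) : ℝ)},
            (#(P \ y • P) : ℝ) ≤ #P / ((M : ℝ) + 1) := by
          intro y hy
          have h1 := hcase y hy
          have h2 : (B ∩ y • B) * A ⊆ P ∩ y • P := by
            refine (inter_mul_subset).trans ?_
            rw [hP, smul_mul_assoc]
          have h3 : #((B ∩ y • B) * A) ≤ #(P ∩ y • P) := card_le_card h2
          have h4 : #(P \ y • P) + #(P ∩ y • P) = #P := card_sdiff_add_card_inter _ _
          have h3' : (#((B ∩ y • B) * A) : ℝ) ≤ #(P ∩ y • P) := by exact_mod_cast h3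
          have h4' : (#(P \ y • P) : ℝ) + #(P ∩ y • P) = #P := by exact_mod_cast h4
          have h5 : (1 - 1 / ((M : ℝ) + 1)) * #P = #P - #P / ((M : ℝ) + 1) := by ring
          linarith
        have hxP := card_sdiff_smul_le_of_mem_pow P _ _ hd M x hx
        have hlt' : (#(P \ x • P) : ℝ) < #P := by
          refine hxP.trans_lt ?_
          rw [← mul_div_assoc, div_lt_iff₀ hM]
          linarith
        obtain ⟨z, hz, hzx⟩ : ∃ z ∈ P, z ∈ x • P := by
          by_contra! hcon
          have : P \ x • P = P := sdiff_eq_self_of_disjoint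
            (disjoint_left.2 hcon)
          rw [this] at hlt'
          exact lt_irrefl _ hlt'
        obtain ⟨w, hw, rfl⟩ := mem_smul_finset.1 hzx
        have hPX : P ⊆ A⁻¹ * A := mul_subset_mul_right hB
        refine mem_mul.2 ⟨_, hPX hz, w⁻¹, ?_, by simp⟩
        have := inv_mem_inv (hPX hw)
        rwa [mul_inv_rev, inv_inv] at this
    · push Not at hcase
      obtain ⟨x, hx, hlt2⟩ := hcase
      obtain ⟨S, hSX, h1, hinv, hcard, hpow⟩ := ih G A (B ∩ x • B) hA hX
        (inter_subset_left.trans hB) (mem_filter.1 hx).2 (by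
          -- The factor vanishes when `M = 0`, and then the strict drop is impossible.
          rcases hδ.eq_or_lt with h0 | h0
          · rw [← h0] at hlt2
            simp only [zero_mul] at hlt2
            exact absurd hlt2 (not_lt.2 (Nat.cast_nonneg _))
          · calc _ < (1 - 1 / ((M : ℝ) + 1)) * #(B * A) * (1 - 1 / ((M : ℝ) + 1)) ^ n := by gcongr
              _ = #(B * A) * (1 - 1 / ((M : ℝ) + 1)) ^ (n + 1) := by ring
              _ < _ := hlt)
      refine ⟨S, hSX, h1, hinv, le_trans ?_ hcard, hpow⟩
      gcongr
      exact min_le_left _ _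

/-- A set `A` with `|A⁻¹A| ≤ k|A|` admits a dense symmetric set whose `M`-fold product lies in
`(A⁻¹A)²`. -/
lemma exists_dense_pow_subset (k : ℝ) (hk : 1 ≤ k) (M : ℕ) :
    ∃ c : ℝ, 0 < c ∧
      ∀ (G : Type u) [Group G] [DecidableEq G] (A : Finset G), A.Nonempty →
        (#(A⁻¹ * A) : ℝ) ≤ k * #A →
        ∃ S ⊆ A⁻¹ * A, 1 ∈ S ∧ S⁻¹ = S ∧ c * #(A⁻¹ * A) ≤ #S ∧
          S ^ M ⊆ (A⁻¹ * A) * (A⁻¹ * A) := by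
  have hM : (0 : ℝ) < (M : ℝ) + 1 := by positivity
  have hδ : 0 ≤ 1 - 1 / ((M : ℝ) + 1) := by
    rw [sub_nonneg, div_le_one hM]; linarith [Nat.cast_nonneg (α := ℝ) M]
  have hδ1 : 1 - 1 / ((M : ℝ) + 1) < 1 := by
    have : 0 < 1 / ((M : ℝ) + 1) := by positivity
    linarith
  obtain ⟨n, hn⟩ := exists_pow_lt_of_lt_one (show 0 < 1 / k by positivity) hδ1
  obtain ⟨c, hc, h⟩ := exists_dense_pow_subset_aux.{u} k hk M n 1 one_pos
  refine ⟨c, hc, fun G _ _ A hA hX => h G A A⁻¹ hA hX subset_rfl (by simp) ?_⟩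
  have hA0 : (0 : ℝ) < #A := by exact_mod_cast hA.card_pos
  calc (#(A⁻¹ * A) : ℝ) * (1 - 1 / ((M : ℝ) + 1)) ^ n
      ≤ (k * #A) * (1 - 1 / ((M : ℝ) + 1)) ^ n := by gcongr
    _ < (k * #A) * (1 / k) := by gcongr
    _ = #A := by field_simp

/-! ### Growth and stabilisation of powers. -/

/-- For `x` in `W ^ (j + 2)` but not in `W ^ (j + 1)`, the translate `xW` misses `W ^ j`, and both
lie in `W ^ (j + 3)`. -/
lemma card_add_card_le_of_pow_ne {G : Type*} [Group G] [DecidableEq G] {W : Finset G}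
    (hW : W⁻¹ = W) (h1 : 1 ∈ W) {j : ℕ} (hne : W ^ (j + 2) ≠ W ^ (j + 1)) :
    #(W ^ j) + #W ≤ #(W ^ (j + 3)) := by
  have hss : W ^ (j + 1) ⊆ W ^ (j + 2) := pow_subset_pow_right h1 (by omega)
  obtain ⟨x, hx, hx'⟩ := exists_of_ssubset (hss.ssubset_of_ne hne.symm)
  have hdisj : Disjoint (W ^ j) (x • W) := by
    rw [disjoint_left]
    intro y hy hyx
    obtain ⟨w, hw, rfl⟩ := mem_smul_finset.1 hyx
    refine hx' ?_
    rw [pow_succ]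
    refine mem_mul.2 ⟨_, hy, w⁻¹, ?_, by simp⟩
    rw [← hW]
    exact inv_mem_inv hw
  rw [← card_smul_finset x W, ← card_union_of_disjoint hdisj]
  refine card_le_card (union_subset (pow_subset_pow_right h1 (by omega)) ?_)
  rw [pow_succ W (j + 2)]
  exact smul_finset_subset_mul hx

lemma exists_pow_succ_eq {G : Type*} [Group G] [DecidableEq G] {W : Finset G}
    (hW : W⁻¹ = W) (h1 : 1 ∈ W) (q : ℕ) (hq : #(W ^ (3 * q + 1)) < (q + 1) * #W) :
    ∃ i, 1 ≤ i ∧ i ≤ 3 * q + 1 ∧ W ^ (i + 1) = W ^ i := by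
  by_contra! hcon
  have key : ∀ r ≤ q, (r + 1) * #W ≤ #(W ^ (3 * r + 1)) := by
    intro r
    induction r with
    | zero => simp
    | succ r ih =>
      intro hr
      have := ih (by omega)
      have h2 := card_add_card_le_of_pow_ne hW h1 (j := 3 * r + 1)
        (hcon (3 * r + 2) (by omega) (by omega))
      calc (r + 1 + 1) * #W = (r + 1) * #W + #W := by ring
        _ ≤ #(W ^ (3 * r + 1)) + #W := by omega
        _ ≤ _ := h2
  exact absurd hq (not_lt.2 (key q le_rfl))

lemma exists_subgroup_of_pow_succ_eq {G : Type*} [Group G] [DecidableEq G] {W : Finset G}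
    (hW : W⁻¹ = W) (h1 : 1 ∈ W) {i : ℕ} (hi : W ^ (i + 1) = W ^ i) :
    ∃ S : Subgroup G, (S : Set G) = (W ^ i : Finset G) := by
  have hstab : ∀ j, W ^ (i + j) = W ^ i := by
    intro j
    induction j with
    | zero => rfl
    | succ j ih => rw [← add_assoc, pow_succ, ih, ← pow_succ, hi]
  refine ⟨{ carrier := (W ^ i : Finset G), mul_mem' := ?_, one_mem' := ?_, inv_mem' := ?_ }, rfl⟩
  · intro a b ha hb
    rw [mem_coe] at *
    rw [← hstab i, pow_add]
    exact mul_mem_mul ha hb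
  · exact one_mem_pow h1
  · intro a ha
    rw [mem_coe] at *
    have := inv_mem_inv ha
    rwa [← inv_pow, hW] at this

/-! ### A dense set whose conjugates lie in a small power. -/

/-- Iterated pigeonhole: a dense part `D` of `A` with all quotients lying close to each of the
sets `Y x`. -/
lemma exists_dense_inv_mul_subset {G : Type*} [Group G] [DecidableEq G] {A : Finset G}
    {r : ℝ} (hr : 1 ≤ r) (Y : G → Finset G) (R : Finset G)
    (hY : ∀ x ∈ R, (Y x).Nonempty ∧ (#(A * Y x) : ℝ) ≤ r * #(Y x)) :
    ∃ D ⊆ A, (#A : ℝ) ≤ r ^ #R * #D ∧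
      ∀ x ∈ R, D⁻¹ * D ⊆ (Y x / Y x) * (Y x / Y x) := by
  induction R using Finset.induction_on with
  | empty => exact ⟨A, subset_rfl, by simp, by simp⟩
  | insert x R hxR ih =>
    obtain ⟨D, hDA, hDc, hD⟩ := ih fun y hy => hY y (mem_insert_of_mem hy)
    obtain ⟨hne, hc⟩ := hY x (mem_insert_self _ _)
    obtain ⟨F, -, hFr, hF⟩ := ruzsa_covering_mul hne hc
    have hf : ∀ d ∈ D, ∃ f ∈ F, f⁻¹ * d ∈ Y x / Y x := by
      intro d hd
      obtain ⟨f, hf, z, hz, hfz⟩ := mem_mul.1 (hF (hDA hd))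
      exact ⟨f, hf, by rw [← hfz]; simpa using hz⟩
    have hcov : D ⊆ F.biUnion fun f => {d ∈ D | f⁻¹ * d ∈ Y x / Y x} := by
      intro d hd
      obtain ⟨f, hf, hfd⟩ := hf d hd
      exact mem_biUnion.2 ⟨f, hf, mem_filter.2 ⟨hd, hfd⟩⟩
    have hex : ∃ f, (#D : ℝ) ≤ r * #{d ∈ D | f⁻¹ * d ∈ Y x / Y x} := by
      by_contra! hcon
      have h1 : (#D : ℝ) ≤ ∑ f ∈ F, (#{d ∈ D | f⁻¹ * d ∈ Y x / Y x} : ℝ) := by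
        exact_mod_cast (card_le_card hcov).trans card_biUnion_le
      rcases F.eq_empty_or_nonempty with hF0 | ⟨f, hf0⟩
      · subst hF0
        have := hcon 1
        simp only [sum_empty] at h1
        have h3 : (0 : ℝ) ≤ r * #{d ∈ D | (1 : G)⁻¹ * d ∈ Y x / Y x} := by positivity
        linarith
      · have h3 : ∑ f ∈ F, (#{d ∈ D | f⁻¹ * d ∈ Y x / Y x} : ℝ) < #F • (#D / r : ℝ) := by
          rw [← sum_const]
          refine sum_lt_sum_of_nonempty ⟨f, hf0⟩ fun f _ => ?_
          rw [lt_div_iff₀ (by positivity), mul_comm]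
          exact hcon f
        have h4 : #F • (#D / r : ℝ) ≤ #D := by
          rw [nsmul_eq_mul]
          calc (#F : ℝ) * (#D / r) ≤ r * (#D / r) := by gcongr
            _ = #D := by field_simp
        linarith
    obtain ⟨f, hfD⟩ := hex
    -- For `d`, `e` in this popular fibre, `d⁻¹e = (f⁻¹d)⁻¹(f⁻¹e)`.
    refine ⟨{d ∈ D | f⁻¹ * d ∈ Y x / Y x}, (filter_subset _ _).trans hDA, ?_, ?_⟩
    · rw [card_insert_of_notMem hxR, pow_succ, mul_assoc]
      exact hDc.trans (by gcongr)
    · intro y hy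
      rcases mem_insert.1 hy with rfl | hy
      · intro z hz
        obtain ⟨d, hd, e, he, rfl⟩ := mem_mul.1 hz
        have hd' := (mem_filter.1 (mem_inv'.1 hd)).2
        have he' := (mem_filter.1 he).2
        refine mem_mul.2 ⟨(f⁻¹ * d⁻¹)⁻¹, ?_, f⁻¹ * e, he', by group⟩
        have := inv_mem_inv hd'
        rwa [div_eq_mul_inv, mul_inv_rev, inv_inv, ← div_eq_mul_inv] at this
      · refine (mul_subset_mul (inv_subset_inv (filter_subset _ _)) (filter_subset _ _)).trans
          (hD y hy)

lemma card_mul_bounds {G : Type*} [Group G] [DecidableEq G] {A : Finset G} {k : ℝ}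
    (hA : A.Nonempty) (h : (#(A * (A⁻¹ * A)) : ℝ) ≤ k * #A) :
    (#((A⁻¹ * A) * (A⁻¹ * A)) : ℝ) ≤ k ^ 2 * #A ∧
    (#(A * ((A⁻¹ * A) * (A⁻¹ * A))) : ℝ) ≤ k ^ 3 * #A ∧
    (#((A⁻¹ * A) * ((A⁻¹ * A) * (A⁻¹ * A))) : ℝ) ≤ k ^ 4 * #A := by
  have hA0 : (0 : ℝ) < #A := by exact_mod_cast hA.card_pos
  have hk : 0 ≤ k := by
    by_contra! hk
    have : k * #A < 0 := mul_neg_of_neg_of_pos hk hA0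
    linarith [Nat.cast_nonneg (α := ℝ) #(A * (A⁻¹ * A))]
  set X := A⁻¹ * A with hX
  have hXi : X⁻¹ = X := by rw [hX, mul_inv_rev, inv_inv]
  have hXA : #(X * A⁻¹) = #(A * X) := by
    rw [← card_inv, mul_inv_rev, inv_inv, hXi]
  have hXXA : #(X * X * A⁻¹) = #(A * (X * X)) := by
    rw [← card_inv, mul_inv_rev, inv_inv, mul_inv_rev, hXi]
  have e2 : (#(X * X) : ℝ) ≤ k ^ 2 * #A := by
    have := ruzsa_triangle_inequality_mul_mul_invMul X A⁻¹ X
    rw [hXi, hXA, card_inv] at this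
    have : (#(X * X) : ℝ) * #A ≤ #(A * X) * #(A * X) := by exact_mod_cast this
    refine le_of_mul_le_mul_right (this.trans ?_) hA0
    calc (#(A * X) : ℝ) * #(A * X) ≤ (k * #A) * (k * #A) := by gcongr
      _ = _ := by ring
  have e3 : (#(A * (X * X)) : ℝ) ≤ k ^ 3 * #A := by
    have := ruzsa_triangle_inequality_mul_mul_invMul (A * A⁻¹) A (A * X)
    rw [mul_inv_rev, hXi, mul_assoc X, ← hX, mul_assoc A A⁻¹ A, ← hX,
      show A * A⁻¹ * (A * X) = A * (X * X) by rw [hX]; simp only [mul_assoc]] at this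
    have : (#(A * (X * X)) : ℝ) * #A ≤ #(A * X) * #(X * X) := by exact_mod_cast this
    refine le_of_mul_le_mul_right (this.trans ?_) hA0
    calc (#(A * X) : ℝ) * #(X * X) ≤ (k * #A) * (k ^ 2 * #A) := by gcongr
      _ = _ := by ring
  refine ⟨e2, e3, ?_⟩
  have := ruzsa_triangle_inequality_mul_mul_invMul X A⁻¹ (X * X)
  rw [mul_inv_rev, hXi, hXA, hXXA, card_inv] at this
  have : (#(X * (X * X)) : ℝ) * #A ≤ #(A * X) * #(A * (X * X)) := by exact_mod_cast this
  refine le_of_mul_le_mul_right (this.trans ?_) hA0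
  calc (#(A * X) : ℝ) * #(A * (X * X)) ≤ (k * #A) * (k ^ 3 * #A) := by gcongr
    _ = _ := by ring

lemma conj_mem_pow_four {G : Type*} [Group G] [DecidableEq G] {S : Finset G} (hS : S⁻¹ = S)
    {x z : G} (hz : z ∈ ({x} * S * {x⁻¹}) / ({x} * S * {x⁻¹}) *
      (({x} * S * {x⁻¹}) / ({x} * S * {x⁻¹}))) :
    x⁻¹ * z * x ∈ S ^ 4 := by
  have key : ∀ w ∈ ({x} * S * {x⁻¹}) / ({x} * S * {x⁻¹}), x⁻¹ * w * x ∈ S ^ 2 := by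
    intro w hw
    obtain ⟨a', ha', b', hb', rfl⟩ := mem_div.1 hw
    rw [mul_assoc, mem_mul] at ha' hb'
    simp only [mem_singleton, mem_mul, exists_eq_left] at ha' hb'
    obtain ⟨_, ⟨a, ha, rfl⟩, rfl⟩ := ha'
    obtain ⟨_, ⟨b, hb, rfl⟩, rfl⟩ := hb'
    rw [sq]
    refine mem_mul.2 ⟨a, ha, b⁻¹, ?_, by simp [div_eq_mul_inv, mul_assoc]⟩
    rw [← hS]
    exact inv_mem_inv hb
  obtain ⟨w, hw, v, hv, rfl⟩ := mem_mul.1 hz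
  rw [show 4 = 2 + 2 from rfl, pow_add]
  exact mem_mul.2 ⟨_, key w hw, _, key v hv, by group⟩

/-- Boundedly many `f ∈ R` give `X ⊆ R S²`. Pigeonholing over the sets `fSf⁻¹` yields a dense `T =
D⁻¹D` with `f⁻¹Tf ⊆ S ^ 4` for every `f ∈ R`; the remaining factor in `S²` enlarges this to `S ^ (2
+ 4 + 2)`. -/
lemma exists_dense_conj_mem_pow (k : ℝ) (hk : 1 ≤ k) (M : ℕ) :
    ∃ c : ℝ, 0 < c ∧
      ∀ (G : Type u) [Group G] [DecidableEq G] (A : Finset G), A.Nonempty →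
        (#(A * (A⁻¹ * A)) : ℝ) ≤ k * #A →
        ∃ T ⊆ A⁻¹ * A, ∃ S : Finset G, 1 ∈ S ∧ S⁻¹ = S ∧
          S ^ M ⊆ (A⁻¹ * A) * (A⁻¹ * A) ∧ c * #(A⁻¹ * A) ≤ #T ∧
          ∀ t ∈ T, ∀ x ∈ A⁻¹ * A, x⁻¹ * t * x ∈ S ^ 8 := by
  obtain ⟨b, hb, hdense⟩ := exists_dense_pow_subset.{u} k hk M
  -- `r` bounds `|A · xSx⁻¹| / |S|` and `ρ` bounds `|R|`; `1 ≤ r` allows `r ^ #R ≤ r ^ ρ`.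
  set r := max 1 (k ^ 3 / b)
  have hr : 1 ≤ r := le_max_left _ _
  set ρ := ⌊k ^ 2 / b⌋₊
  refine ⟨1 / (k * r ^ ρ), by positivity, fun G _ _ A hA hAX => ?_⟩
  obtain ⟨h2, h3, -⟩ := card_mul_bounds hA hAX
  have hXA : (#(A⁻¹ * A) : ℝ) ≤ k * #A := by
    refine le_trans ?_ hAX
    exact_mod_cast card_le_card_mul_left hA
  have hAleX : (#A : ℝ) ≤ #(A⁻¹ * A) := by
    exact_mod_cast card_le_card_mul_left hA.inv
  obtain ⟨S, hSX, h1, hS, hSc, hSM⟩ := hdense G A hA hXA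
  set X := A⁻¹ * A with hX
  have hAS : (#A : ℝ) ≤ #S / b := by
    rw [le_div_iff₀ hb, mul_comm]
    exact le_trans (by gcongr) hSc
  have hXS : (#(X * S) : ℝ) ≤ k ^ 2 / b * #S := by
    calc (#(X * S) : ℝ) ≤ #(X * X) := by
          exact_mod_cast card_le_card (mul_subset_mul_left hSX)
      _ ≤ k ^ 2 * #A := h2
      _ ≤ k ^ 2 * (#S / b) := by gcongr
      _ = _ := by ring
  obtain ⟨R, hRX, hRc, hR⟩ := ruzsa_covering_mul ⟨1, h1⟩ hXS
  have hY : ∀ x ∈ R, ({x} * S * {x⁻¹} : Finset G).Nonempty ∧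
      (#(A * ({x} * S * {x⁻¹})) : ℝ) ≤ r * #({x} * S * {x⁻¹} : Finset G) := by
    intro x hx
    refine ⟨⟨x * 1 * x⁻¹, mul_mem_mul (mul_mem_mul (mem_singleton_self _) h1)
      (mem_singleton_self _)⟩, ?_⟩
    rw [← mul_assoc, card_mul_singleton, card_mul_singleton, card_singleton_mul]
    calc (#(A * ({x} * S)) : ℝ) ≤ #(A * (X * X)) := by
          exact_mod_cast card_le_card (mul_subset_mul_left
            (mul_subset_mul (singleton_subset_iff.2 (hRX hx)) hSX))
      _ ≤ k ^ 3 * #A := h3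
      _ ≤ k ^ 3 * (#S / b) := by gcongr
      _ = k ^ 3 / b * #S := by ring
      _ ≤ r * #S := by gcongr; exact le_max_right _ _
  obtain ⟨D, hDA, hDc, hD⟩ :=
    exists_dense_inv_mul_subset hr (fun x => {x} * S * {x⁻¹}) R hY
  refine ⟨D⁻¹ * D, mul_subset_mul (inv_subset_inv hDA) hDA, S, h1, hS, hSM, ?_, ?_⟩
  · have hDn : D.Nonempty := by
      rw [nonempty_iff_ne_empty]
      rintro rfl
      rw [card_empty, Nat.cast_zero, mul_zero, Nat.cast_nonpos, card_eq_zero] at hDc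
      exact hA.ne_empty hDc
    have hDD : (#D : ℝ) ≤ #(D⁻¹ * D) := by
      exact_mod_cast card_le_card_mul_left hDn.inv
    have hRρ : #R ≤ ρ := Nat.le_floor hRc
    rw [one_div, inv_mul_le_iff₀ (by positivity)]
    calc (#X : ℝ) ≤ k * #A := hXA
      _ ≤ k * (r ^ #R * #D) := by gcongr
      _ ≤ k * (r ^ ρ * #(D⁻¹ * D)) := by gcongr
      _ = _ := by ring
  · intro t ht x hx
    obtain ⟨f, hf, z, hz, rfl⟩ := mem_mul.1 (hR hx)
    have h4 := conj_mem_pow_four hS (hD f hf ht)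
    rw [div_eq_mul_inv, hS, ← sq] at hz
    have hz' : z⁻¹ ∈ S ^ 2 := by
      have := inv_mem_inv hz
      rwa [← inv_pow, hS] at this
    rw [show 8 = 2 + 4 + 2 from rfl, pow_add, pow_add]
    exact mem_mul.2 ⟨_, mul_mem_mul hz' h4, z, hz, by group⟩

/-! ### From random tuples to the subgroup. -/

lemma conjProd_subset_pow {G : Type*} [Group G] [DecidableEq G] {X T U : Finset G}
    (h : ∀ t ∈ T, ∀ x ∈ X, x⁻¹ * t * x ∈ U) {l : ℕ} (a : Fin l → G) (ha : ∀ i, a i ∈ T) :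
    conjProd X a ⊆ U ^ l := by
  induction l with
  | zero => simp [conjProd]
  | succ l ih =>
    rw [conjProd, List.ofFn_succ, List.prod_cons, pow_succ']
    refine mul_subset_mul ?_ (ih (fun i => a i.succ) fun i => ha _)
    intro y hy
    obtain ⟨x, hx, rfl⟩ := mem_image.1 hy
    exact h _ (ha 0) x hx

/-- A property of high probability holds for some tuple from a given dense subset. -/
lemma exists_mem_of_le_tupleProb {G : Type*} {X T : Finset G} (hX : X.Nonempty) (hT : T ⊆ X)
    {c : ℝ} (hc : 0 < c) (hcT : c * #X ≤ #T) {l : ℕ} {P : (Fin l → G) → Prop}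
    (hP : 1 - c ^ l / 2 ≤ tupleProb X l P) : ∃ a : Fin l → G, (∀ i, a i ∈ T) ∧ P a := by
  classical
  by_contra! hcon
  have hX0 : (0 : ℝ) < #X := by exact_mod_cast hX.card_pos
  have hdisj : Disjoint ((Fintype.piFinset (fun _ : Fin l => X)).filter P)
      (Fintype.piFinset (fun _ : Fin l => T)) := by
    rw [disjoint_left]
    intro a ha ha'
    exact hcon a (Fintype.mem_piFinset.1 ha') (mem_filter.1 ha).2
  have hcard := card_le_card (union_subset
    (filter_subset P (Fintype.piFinset (fun _ : Fin l => X)))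
    (Fintype.piFinset_subset (fun _ : Fin l => T) (fun _ => X) fun _ => hT))
  rw [card_union_of_disjoint hdisj, Fintype.card_piFinset_const, Fintype.card_piFinset_const]
    at hcard
  have hcard' : (#((Fintype.piFinset (fun _ : Fin l => X)).filter P) : ℝ) + (#T : ℝ) ^ l ≤
      (#X : ℝ) ^ l := by exact_mod_cast hcard
  have hTl : (c * #X) ^ l ≤ (#T : ℝ) ^ l := by gcongr
  have hXl : 0 < (#X : ℝ) ^ l := by positivity
  have hcl : 0 < c ^ l := by positivity
  rw [tupleProb, Fintype.card_piFinset_const, Nat.cast_pow, le_div_iff₀ hXl] at hP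
  rw [mul_pow] at hTl
  have h5 : (#((Fintype.piFinset (fun _ : Fin l => X)).filter P) : ℝ) ≥
      (1 - c ^ l / 2) * (#X : ℝ) ^ l := by convert hP
  nlinarith [mul_pos hcl hXl]

theorem mainTheorem6 (k l m : ℕ) (hm : 0 < m) :
    ∃ (p : ℝ) (K : ℕ), p < 1 ∧
      ∀ (G : Type*) [Group G] [DecidableEq G] (X₀ X : Finset G),
        X₀.Nonempty →
        X = X₀⁻¹ * X₀ →
        (X₀ * X).card ≤ k * X₀.card →
        p ≤ tupleProb X l (fun a => (X.card : ℝ) / (m : ℝ) ≤ ((conjProd X a).card : ℝ)) →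
        ∃ S : Subgroup G, (S : Set G) ⊆ ((X * X : Finset G) : Set G) ∧ CoveredByCosets X S K := by
  rcases Nat.eq_zero_or_pos k with rfl | hk
  · refine ⟨0, 0, one_pos, fun G _ _ A X hA hX hAX _ => ?_⟩
    have : (A * X).Nonempty := by
      rw [hX]
      exact hA.mul (hA.inv.mul hA)
    have := this.card_pos
    omega
  have hk1 : (1 : ℝ) ≤ k := by exact_mod_cast hk
  -- `|X²| ≤ k²|A| ≤ q|W|`, so stabilisation occurs by exponent `3q + 1`; the power of `S` needed is
  -- therefore `8l(3q + 1)`.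
  set q := k ^ 2 * m
  obtain ⟨c, hc, hdense⟩ := exists_dense_conj_mem_pow (k : ℝ) hk1 (8 * l * (3 * q + 1))
  -- `T` fills at least `c ^ l` of the `l`-tuples, which fixes `p`; `K` comes from `|X³| ≤ k⁴|A| ≤
  -- k⁴m|W ^ i|`.
  refine ⟨1 - c ^ l / 2, k ^ 4 * m, by linarith [pow_pos hc l], fun G _ _ A X hA hX hAX hP => ?_⟩
  subst hX
  have hAX' : (#(A * (A⁻¹ * A)) : ℝ) ≤ k * #A := by exact_mod_cast hAX
  obtain ⟨T, hT, S, h1, hS, hSM, hTc, hconj⟩ := hdense G A hA hAX'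
  obtain ⟨h2, -, h4⟩ := card_mul_bounds hA hAX'
  have hAleX : (#A : ℝ) ≤ #(A⁻¹ * A) := by
    exact_mod_cast card_le_card_mul_left hA.inv
  have hXn : (A⁻¹ * A).Nonempty := hA.inv.mul hA
  obtain ⟨a, haT, ha⟩ := exists_mem_of_le_tupleProb hXn hT hc hTc hP
  set X := A⁻¹ * A with hX
  have hm0 : (0 : ℝ) < m := by exact_mod_cast hm
  obtain ⟨W, hWdef⟩ : ∃ W, W = S ^ (8 * l) := ⟨_, rfl⟩
  have hW1 : 1 ∈ W := hWdef ▸ one_mem_pow h1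
  have hWinv : W⁻¹ = W := by rw [hWdef, ← inv_pow, hS]
  have hWN : W ^ (3 * q + 1) ⊆ X * X := by rw [hWdef, ← pow_mul]; exact hSM
  have hXW : (#X : ℝ) ≤ m * #W := by
    rw [div_le_iff₀ hm0] at ha
    refine ha.trans ?_
    rw [mul_comm]
    gcongr
    rw [hWdef, pow_mul]
    exact conjProd_subset_pow hconj a haT
  have hW0 : (0 : ℝ) < #W := by exact_mod_cast card_pos.2 ⟨1, hW1⟩
  have hq : #(W ^ (3 * q + 1)) < (q + 1) * #W := by
    have : (#(W ^ (3 * q + 1)) : ℝ) < (q + 1) * #W := by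
      calc (#(W ^ (3 * q + 1)) : ℝ) ≤ #(X * X) := by exact_mod_cast card_le_card hWN
        _ ≤ k ^ 2 * #A := h2
        _ ≤ k ^ 2 * (m * #W) := by gcongr; exact hAleX.trans hXW
        _ = q * #W := by simp only [q]; push_cast; ring
        _ < _ := by linarith
    exact_mod_cast this
  obtain ⟨i, hi1, hiN, hi⟩ := exists_pow_succ_eq hWinv hW1 q hq
  obtain ⟨H, hH⟩ := exists_subgroup_of_pow_succ_eq hWinv hW1 hi
  have hWi : W ^ i ⊆ X * X := (pow_subset_pow_right hW1 hiN).trans hWN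
  refine ⟨H, by rw [hH]; exact_mod_cast hWi, ?_⟩
  have hcov : (#(X * W ^ i) : ℝ) ≤ ((k ^ 4 * m : ℕ) : ℝ) * #(W ^ i) := by
    have hle : (#W : ℝ) ≤ #(W ^ i) := by
      exact_mod_cast card_le_card (by simpa using pow_subset_pow_right hW1 hi1)
    calc (#(X * W ^ i) : ℝ) ≤ #(X * (X * X)) := by
          exact_mod_cast card_le_card (mul_subset_mul_left hWi)
      _ ≤ k ^ 4 * #A := h4
      _ ≤ k ^ 4 * (m * #(W ^ i)) := by gcongr; exact hAleX.trans (hXW.trans (by gcongr))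
      _ = _ := by push_cast; ring
  obtain ⟨F, -, hFc, hF⟩ := ruzsa_covering_mul ⟨1, one_mem_pow hW1⟩ hcov
  refine ⟨F, by exact_mod_cast hFc, fun x hx => ?_⟩
  obtain ⟨f, hf, z, hz, rfl⟩ := mem_mul.1 (hF hx)
  rw [Set.mem_iUnion₂]
  refine ⟨f, hf, ?_⟩
  rw [← smul_eq_mul]
  refine Set.smul_mem_smul_set ?_
  obtain ⟨u, hu, v, hv, rfl⟩ := mem_div.1 hz
  have hmem : ∀ y ∈ W ^ i, y ∈ H := fun y hy => by
    rw [← SetLike.mem_coe, hH]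
    exact hy
  exact H.div_mem (hmem u hu) (hmem v hv)
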